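/- Let $\mathcal T=\mathbb R/2\pi\mathbb Z$ and let $\mathcal M^0_{\mathcal T}$ be the set of Borel probability measures $\mu$ on $\mathcal T$ with $\int_{\mathcal T}e^{i\theta}\,d\mu(\theta)=0$. For $\mu\in\mathcal M^0_{\mathcal T}$ let $F_\mu(x)=\mu([0,x])$, $F_\mu^{-1}(y)=\inf\{x\ge 0: F_\mu(x)\ge y\}$, $Z_\mu(t)=\int_0^t e^{iF_\mu^{-1}(u)}\,du\in\mathbb C$ for $t\in[0,1]$, and $\mathcal B_\mu=\{Z_\mu(t):t\in[0,1]\}$. Let $\mathcal C_\mu$ be the compact convex set with boundary $\mathcal B_\mu$ (a segment being its own boundary), that is, the convex hull of $\mathcal B_\mu$, and let $\mathcal A(\mu)$ be the area (Lebesgue measure) of $\mathcal C_\mu$. Let $\star$ denote convolution of measures on $\mathcal T$ and let $\mathbf u$ be the uniform probability measure on $\mathcal T$. Theorem. For all $\mu,\nu\in\mathcal M^0_{\mathcal T}$ one has $\mu\star\nu\in\mathcal M^0_{\mathcal T}$, and convolution does not decrease the area: $$\mathcal A(\mu\star\nu)\ \ge\ \max\{\mathcal A(\mu),\mathcal A(\nu)\}.$$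 Moreover $\mathbf u\in\mathcal M^0_{\mathcal T}$; $\mathbf u$ is absorbing, i.e. $\mathbf u\star\nu=\nu\star\mathbf u=\mathbf u$ for every probability measure $\nu$ on $\mathcal T$; $\mathcal B_{\mathbf u}$ is the circle with centre $i/(2\pi)$ and radius $1/(2\pi)$ (hence of perimeter $1$), and $\mathcal C_{\mathbf u}$ is the closed disc that it bounds. Finally, the isoperimetric inequality holds: $$\mathcal A(\mathbf u)\ \ge\ \mathcal A(\nu)\qquad\text{for all }\nu\in\mathcal M^0_{\mathcal T}.$$ -/

import Mathlib

open MeasureTheory Set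
open scoped Real

namespace CCS

noncomputable section

/-- `2π > 0`, in the form in which Mathlib's library on `AddCircle` asks for it. -/
instance factTwoPiPos : Fact ((0 : ℝ) < 2 * π) := ⟨Real.two_pi_pos⟩

/-- The circle `ℝ / 2πℤ`. -/
abbrev Torus : Type := AddCircle (2 * π)

/-- The character `θ ↦ exp(iθ)` on `ℝ / 2πℤ`. -/
def expI (θ : Torus) : ℂ := (AddCircle.toCircle θ : ℂ)

/-- On representatives, `expI` is `x ↦ exp(ix)`. -/
theorem expI_coe (x : ℝ) : expI (x : Torus) = Complex.exp (Complex.I * x) := by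
  have h : 2 * π / (2 * π) * x = x := by
    rw [div_self Real.two_pi_pos.ne', one_mul]
  rw [expI, AddCircle.toCircle_apply_mk, h, Circle.coe_exp, mul_comm]

/-- The probability measures `μ` on `ℝ / 2πℤ` with `∫ exp(iθ) dμ(θ) = 0`. -/
def centredLaws : Set (Measure Torus) :=
  {μ | IsProbabilityMeasure μ ∧ ∫ θ, expI θ ∂μ = 0}

/-- The uniform probability measure on `ℝ / 2πℤ`. -/
def uniformLaw : Measure Torus := AddCircle.haarAddCircle

/-- The cumulative distribution function `F_μ(x) = μ([0, x])` (used for `x ≥ 0`; `[0, x]` is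
the whole circle when `x ≥ 2π`). -/
def cdf (μ : Measure Torus) (x : ℝ) : ℝ := μ.real ((fun y : ℝ => (y : Torus)) '' Icc 0 x)

/-- The generalised inverse `F_μ⁻¹(y) = inf {x ≥ 0 : F_μ(x) ≥ y}`. -/
def quantile (μ : Measure Torus) (y : ℝ) : ℝ := sInf {x : ℝ | 0 ≤ x ∧ y ≤ cdf μ x}

/-- The curve `Z_μ(t) = ∫₀ᵗ exp(i F_μ⁻¹(u)) du`. -/
def curve (μ : Measure Torus) (t : ℝ) : ℂ :=
  ∫ u in (0 : ℝ)..t, Complex.exp (Complex.I * (quantile μ u : ℂ))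

/-- The range `B_μ = {Z_μ(t) : t ∈ [0, 1]}`. -/
def boundaryCurve (μ : Measure Torus) : Set ℂ := curve μ '' Icc 0 1

/-- The compact convex set `C_μ` with boundary `B_μ`, obtained as the convex hull of `B_μ`.
By `eq_convexHull_of_frontier_eq` below it is the only candidate. -/
def convexSet (μ : Measure Torus) : Set ℂ := convexHull ℝ (boundaryCurve μ)

/-- A compact convex subset of the plane (a segment included, which is its own frontier) is the
convex hull of its frontier; so a compact convex set with boundary `B` is unique, and is the
convex hull of `B`. -/
theorem eq_convexHull_of_frontier_eq {C B : Set ℂ} (hc : IsCompact C) (hC : Convex ℝ C)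
    (hB : frontier C = B) : C = convexHull ℝ B := by
  subst hB
  have hf : frontier C ⊆ C := hc.isClosed.frontier_subset
  refine Subset.antisymm (fun x hx => ?_) (convexHull_min hf hC)
  have key : ∀ e : ℂ, e ≠ 0 → ∃ s : ℝ, 0 ≤ s ∧ x + (s : ℂ) * e ∈ frontier C := by
    intro e he
    have hcont : Continuous fun s : ℝ => x + (s : ℂ) * e := by fun_prop
    have hmem : ((fun s : ℝ => x + (s : ℂ) * e) ⁻¹' frontier C ∩ Ici 0).Nonempty := by
      by_contra hne
      rw [not_nonempty_iff_eq_empty] at hne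
      obtain ⟨R, hR⟩ := hc.isBounded.exists_norm_le
      have hpre : IsPreconnected ((fun s : ℝ => x + (s : ℂ) * e) '' Ici 0) :=
        isPreconnected_Ici.image _ hcont.continuousOn
      have hsub : (fun s : ℝ => x + (s : ℂ) * e) '' Ici 0 ⊆ C := by
        by_contra hns
        obtain ⟨y, hy, hyC⟩ := not_subset.1 hns
        have hor : ∀ z ∈ (fun s : ℝ => x + (s : ℂ) * e) '' Ici 0, z ∈ interior C ∨ z ∈ Cᶜ := by
          rintro z ⟨s, hs, rfl⟩
          by_contra hz
          rw [not_or, notMem_compl_iff] at hz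
          have hzf : x + (s : ℂ) * e ∈ frontier C := by
            rw [hc.isClosed.frontier_eq]
            exact ⟨hz.2, hz.1⟩
          exact (hne ▸ (⟨hzf, hs⟩ : s ∈ _ ∩ Ici 0) : s ∈ (∅ : Set ℝ))
        have hx0 : x ∈ (fun s : ℝ => x + (s : ℂ) * e) '' Ici 0 := ⟨0, by simp, by simp⟩
        obtain ⟨z, -, hz1, hz2⟩ := hpre _ _ isOpen_interior hc.isClosed.isOpen_compl hor
          ⟨x, hx0, (hor x hx0).resolve_right (fun h => h hx)⟩ ⟨y, hy, hyC⟩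
        exact hz2 (interior_subset hz1)
      have hepos : 0 < ‖e‖ := norm_pos_iff.2 he
      have hR0 : 0 ≤ R := (norm_nonneg x).trans (hR x hx)
      have hs0 : 0 ≤ (2 * R + 1) / ‖e‖ := by positivity
      have h1 := hR _ (hsub ⟨(2 * R + 1) / ‖e‖, hs0, rfl⟩)
      have h2 : ‖(((2 * R + 1) / ‖e‖ : ℝ) : ℂ) * e‖ = 2 * R + 1 := by
        rw [norm_mul, Complex.norm_real, Real.norm_of_nonneg hs0, div_mul_cancel₀ _ hepos.ne']
      have h3 := norm_sub_le (x + (((2 * R + 1) / ‖e‖ : ℝ) : ℂ) * e) x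
      rw [add_sub_cancel_left, h2] at h3
      have h4 := hR x hx
      simp only at h1
      linarith
    obtain ⟨s, hs, hs0⟩ := hmem
    exact ⟨s, hs0, hs⟩
  obtain ⟨s, hs, hsf⟩ := key 1 one_ne_zero
  obtain ⟨t, ht, htf⟩ := key (-1) (by simp)
  rcases (add_nonneg hs ht).eq_or_lt with h0 | hpos
  · have : s = 0 := by linarith
    subst this
    exact subset_convexHull ℝ _ (by simpa using hsf)
  · refine (convex_convexHull ℝ (frontier C)).segment_subset (subset_convexHull ℝ _ hsf)
      (subset_convexHull ℝ _ htf) ⟨t / (s + t), s / (s + t), by positivity, by positivity, ?_, ?_⟩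
    · field_simp
      ring
    · have hne : (s : ℂ) + t ≠ 0 := by exact_mod_cast hpos.ne'
      simp only [Complex.real_smul]
      push_cast
      field_simp
      ring

/-- The area `A(μ)` of `C_μ`: its two-dimensional Lebesgue measure. -/
def area (μ : Measure Torus) : ENNReal := volume (convexSet μ)

end

end CCS

namespace CCS

/-! The idea is to diagonalise the area by Fourier series. With `Θ` the tangent angle, a uniform
variable on the unit interval is carried by `Θ` to `μ`, and the centring condition says that the
curve closes up. Its tangent turns monotonically through at most one full turn, so the curve is
convex, and slicing its hull horizontally gives Green's formula: the area is `∫ Re Z · sin Θ`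
(`volume_convexHull_arc`).

Writing `Re Z` as an integral of `cos Θ` and antisymmetrising, with the means of `cos Θ` and `sin Θ`
equal to zero, turns four times the area into the mean of `sin |Θ s - Θ t|` over the unit square
(`integral_sin_abs`). As a function of `d = Θ s - Θ t` this is not `2π`-periodic, but subtracting `d
sin d / π`, which has mean zero by centring (`integral_sub_mul_sin_sub`), makes it so. Hence four
times the area is the energy `∬ k(x - y) dμ dμ` of the periodic kernel `k(d) = (1 - d/π) sin d` on
`[0, 2π)` (`integral_kernel`), that is, `∑ c_n |μ̂(n)|²`.

For `n ≠ ±1` one has `c_n = -1/(π(n² - 1))`, which is negative for `|n| ≥ 2`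
(`fourierCoeff_kernel`). The term `n = 0` is the same for all laws and the terms `n = ±1` vanish by
centring. Convolution multiplies the other `μ̂(n)` by numbers of modulus at most `1`, so the area
cannot decrease (`area_le_area_conv`). As the uniform law is absorbing, the isoperimetric inequality
follows. -/

/-- The curve with unit speed whose tangent has the angle `Θ`. -/
noncomputable def arc (Θ : ℝ → ℝ) (t : ℝ) : ℂ := ∫ u in (0 : ℝ)..t, Complex.exp (Complex.I * (Θ u : ℂ))

/-! ### Closed curves with monotone tangent angle, and their supporting lines. -/

section Arc

variable {Θ : ℝ → ℝ}

theorem intervalIntegrable_of_bounded {E : Type*} [NormedAddCommGroup E] {f : ℝ → E} (C : ℝ)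
    (hf : AEStronglyMeasurable f) (hC : ∀ t, ‖f t‖ ≤ C) (a b : ℝ) :
    IntervalIntegrable f volume a b :=
  (intervalIntegrable_const (c := C)).mono_fun hf.restrict
    (Filter.Eventually.of_forall fun t => (hC t).trans (le_abs_self C))

theorem intervalIntegrable_exp (hΘ : Monotone Θ) (a b : ℝ) :
    IntervalIntegrable (fun u => Complex.exp (Complex.I * (Θ u : ℂ))) volume a b := by
  refine intervalIntegrable_of_bounded 1 ?_ (fun t => ?_) a b
  · have := hΘ.measurable
    exact Measurable.aestronglyMeasurable (by fun_prop)
  · rw [mul_comm, Complex.norm_exp_ofReal_mul_I]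

theorem intervalIntegrable_sin (hΘ : Monotone Θ) (α a b : ℝ) :
    IntervalIntegrable (fun u => Real.sin (Θ u - α)) volume a b := by
  refine intervalIntegrable_of_bounded 1 ?_ (fun t => Real.abs_sin_le_one _) a b
  have := hΘ.measurable
  exact Measurable.aestronglyMeasurable (by fun_prop)

theorem intervalIntegrable_sin' (hΘ : Monotone Θ) (a b : ℝ) :
    IntervalIntegrable (fun u => Real.sin (Θ u)) volume a b := by
  simpa using intervalIntegrable_sin hΘ 0 a b

theorem intervalIntegrable_cos (hΘ : Monotone Θ) (a b : ℝ) :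
    IntervalIntegrable (fun u => Real.cos (Θ u)) volume a b := by
  refine intervalIntegrable_of_bounded 1 ?_ (fun t => Real.abs_cos_le_one _) a b
  have := hΘ.measurable
  exact Measurable.aestronglyMeasurable (by fun_prop)

theorem integral_nonpos_of_le {f : ℝ → ℝ} {a b : ℝ} (hab : a ≤ b)
    (hf : ∀ u ∈ Icc a b, f u ≤ 0) : ∫ u in a..b, f u ≤ 0 := by
  have := intervalIntegral.integral_nonneg (μ := volume) hab fun u hu => neg_nonneg.2 (hf u hu)
  rw [intervalIntegral.integral_neg] at this
  linarith

theorem re_arc (hΘ : Monotone Θ) (t : ℝ) : (arc Θ t).re = ∫ u in (0 : ℝ)..t, Real.cos (Θ u) := by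
  have := Complex.reCLM.intervalIntegral_comp_comm (intervalIntegrable_exp hΘ 0 t)
  simp only [Complex.reCLM_apply] at this
  rw [arc, ← this]
  refine intervalIntegral.integral_congr fun u _ => ?_
  simp only [mul_comm Complex.I, Complex.exp_ofReal_mul_I_re]

theorem im_arc (hΘ : Monotone Θ) (t : ℝ) : (arc Θ t).im = ∫ u in (0 : ℝ)..t, Real.sin (Θ u) := by
  have := Complex.imCLM.intervalIntegral_comp_comm (intervalIntegrable_exp hΘ 0 t)
  simp only [Complex.imCLM_apply] at this
  rw [arc, ← this]
  refine intervalIntegral.integral_congr fun u _ => ?_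
  simp only [mul_comm Complex.I, Complex.exp_ofReal_mul_I_im]

theorem continuous_arc (hΘ : Monotone Θ) : Continuous (arc Θ) :=
  intervalIntegral.continuous_primitive (intervalIntegrable_exp hΘ) 0

theorem arc_zero : arc Θ 0 = 0 := by simp [arc]

theorem im_arc_sub (hΘ : Monotone Θ) (s t : ℝ) :
    (arc Θ t).im - (arc Θ s).im = ∫ u in s..t, Real.sin (Θ u) := by
  rw [im_arc hΘ, im_arc hΘ]
  exact intervalIntegral.integral_interval_sub_left (intervalIntegrable_sin' hΘ _ _)
    (intervalIntegrable_sin' hΘ _ _)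

theorem re_arc_sub (hΘ : Monotone Θ) (s t : ℝ) :
    (arc Θ t).re - (arc Θ s).re = ∫ u in s..t, Real.cos (Θ u) := by
  rw [re_arc hΘ, re_arc hΘ]
  exact intervalIntegral.integral_interval_sub_left (intervalIntegrable_cos hΘ _ _)
    (intervalIntegrable_cos hΘ _ _)

theorem integral_sin_sub (hΘ : Monotone Θ) (α s t : ℝ) :
    ∫ u in s..t, Real.sin (Θ u - α) = Real.cos α * ((arc Θ t).im - (arc Θ s).im) -
      Real.sin α * ((arc Θ t).re - (arc Θ s).re) := by
  rw [im_arc_sub hΘ, re_arc_sub hΘ, ← intervalIntegral.integral_const_mul,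
    ← intervalIntegral.integral_const_mul, ← intervalIntegral.integral_sub
      ((intervalIntegrable_sin' hΘ _ _).const_mul _) ((intervalIntegrable_cos hΘ _ _).const_mul _)]
  refine intervalIntegral.integral_congr fun u _ => ?_
  simp only [Real.sin_sub]
  ring

/-- A closed curve whose tangent turns monotonically once lies to the left of its tangents. -/
theorem integral_sin_sub_nonneg (hΘ : Monotone Θ) (h0 : ∀ t, 0 ≤ Θ t) (h2 : ∀ t, Θ t ≤ 2 * π)
    (h1 : arc Θ 1 = 0) {s t : ℝ} (hs : s ∈ Icc (0 : ℝ) 1) (ht : t ∈ Icc (0 : ℝ) 1) :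
    0 ≤ ∫ u in s..t, Real.sin (Θ u - Θ s) := by
  have hI := intervalIntegrable_sin hΘ (Θ s)
  -- The curve is closed, so an integral over a stretch of mixed sign can be read off from its
  -- complement.
  have hper : ∫ u in (0 : ℝ)..1, Real.sin (Θ u - Θ s) = 0 := by
    rw [integral_sin_sub hΘ, h1, arc_zero]; simp
  have hpos : ∀ a b, a ≤ b → Θ b - Θ s ≤ π → 0 ≤ Θ a - Θ s →
      0 ≤ ∫ u in a..b, Real.sin (Θ u - Θ s) := fun a b hab h h' =>
    intervalIntegral.integral_nonneg hab fun u hu => Real.sin_nonneg_of_nonneg_of_le_pi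
      (by linarith [hΘ hu.1]) (by linarith [hΘ hu.2])
  have hneg : ∀ a b, a ≤ b → Θ b - Θ s ≤ 0 → -π ≤ Θ a - Θ s →
      ∫ u in a..b, Real.sin (Θ u - Θ s) ≤ 0 := fun a b hab h h' =>
    integral_nonpos_of_le hab fun u hu => Real.sin_nonpos_of_nonpos_of_neg_pi_le
      (by linarith [hΘ hu.2]) (by linarith [hΘ hu.1])
  have hpos' : ∀ a b, a ≤ b → Θ b - Θ s ≤ -π → -(2 * π) ≤ Θ a - Θ s →
      0 ≤ ∫ u in a..b, Real.sin (Θ u - Θ s) := fun a b hab h h' =>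
    intervalIntegral.integral_nonneg hab fun u hu => by
      rw [← Real.sin_add_two_pi]
      exact Real.sin_nonneg_of_nonneg_of_le_pi (by linarith [hΘ hu.1]) (by linarith [hΘ hu.2])
  have hneg' : ∀ a b, a ≤ b → Θ b - Θ s ≤ 2 * π → π ≤ Θ a - Θ s →
      ∫ u in a..b, Real.sin (Θ u - Θ s) ≤ 0 := fun a b hab h h' =>
    integral_nonpos_of_le hab fun u hu => by
      rw [← Real.sin_sub_two_pi]
      exact Real.sin_nonpos_of_nonpos_of_neg_pi_le (by linarith [hΘ hu.2]) (by linarith [hΘ hu.1])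
  have e1 := intervalIntegral.integral_add_adjacent_intervals (hI 0 s) (hI s 1)
  have e2 := intervalIntegral.integral_add_adjacent_intervals (hI s t) (hI t 1)
  have e3 := intervalIntegral.integral_add_adjacent_intervals (hI 0 s) (hI s t)
  have e4 := intervalIntegral.integral_add_adjacent_intervals (hI 0 t) (hI t 1)
  have e5 := intervalIntegral.integral_symm (μ := volume) (f := fun u => Real.sin (Θ u - Θ s)) s t
  -- If `Θ s ≤ π`, the integrand is nonpositive before `s`, nonnegative after `s` until the angle
  -- has turned by `π`, and nonpositive from there on. In the last stretch the pieces over `[0, s]`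
  -- and `[t, 1]` are both nonpositive and the total is zero. The case `Θ s ≥ π` is its mirror
  -- image.
  rcases le_total (Θ s) π with hc | hc
  · have k1 := hneg 0 s hs.1 (by linarith) (by linarith [h0 0])
    rcases le_total t s with hts | hts
    · have := hneg t s hts (by linarith) (by linarith [h0 t])
      linarith
    · rcases le_total (Θ t - Θ s) π with hd | hd
      · exact hpos s t hts hd (by linarith)
      · have := hneg' t 1 ht.2 (by linarith [h2 1, h0 s]) hd
        linarith
  · have k1 := hpos s 1 hs.2 (by linarith [h2 1]) (by linarith)
    rcases le_total s t with hts | hts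
    · exact hpos s t hts (by linarith [h2 t]) (by linarith)
    · rcases le_total (-π) (Θ t - Θ s) with hd | hd
      · have := hneg t s hts (by linarith) hd
        linarith
      · have := hpos' 0 t ht.1 hd (by linarith [h0 0, h2 s])
        linarith

/-- The closed convex hull of the curve. -/
noncomputable def hull (Θ : ℝ → ℝ) : Set ℂ := closure (convexHull ℝ (arc Θ '' Icc 0 1))

theorem arc_mem_hull {t : ℝ} (ht : t ∈ Icc (0 : ℝ) 1) : arc Θ t ∈ hull Θ :=
  subset_closure (subset_convexHull ℝ _ ⟨t, ht, rfl⟩)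

theorem convex_halfPlane (a b c : ℝ) : Convex ℝ {z : ℂ | c ≤ a * z.im + b * z.re} := by
  intro z hz w hw p q hp hq hpq
  simp only [mem_ofPred_eq, Complex.add_im, Complex.add_re, Complex.real_smul, Complex.mul_im,
    Complex.mul_re, Complex.ofReal_re, Complex.ofReal_im] at *
  have h1 := mul_le_mul_of_nonneg_left hz hp
  have h2 := mul_le_mul_of_nonneg_left hw hq
  have h3 : p * c + q * c = c := by rw [← add_mul, hpq, one_mul]
  linarith

theorem hull_subset_halfPlane {a b c : ℝ}
    (h : ∀ t ∈ Icc (0 : ℝ) 1, c ≤ a * (arc Θ t).im + b * (arc Θ t).re) {z : ℂ}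
    (hz : z ∈ hull Θ) : c ≤ a * z.im + b * z.re :=
  closure_minimal (convexHull_min (by rintro _ ⟨t, ht, rfl⟩; exact h t ht)
    (convex_halfPlane a b c)) (isClosed_le (by fun_prop) (by fun_prop)) hz

theorem convex_hull (Θ : ℝ → ℝ) : Convex ℝ (hull Θ) := (convex_convexHull ℝ _).closure

/-- The frontier of a convex set is null, so passing to the closure, which is evidently measurable,
costs nothing. -/
theorem volume_hull (Θ : ℝ → ℝ) : volume (hull Θ) = volume (convexHull ℝ (arc Θ '' Icc 0 1)) := by
  refine le_antisymm ?_ (measure_mono subset_closure)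
  rw [hull, closure_eq_self_union_frontier]
  refine (measure_union_le _ _).trans ?_
  rw [Convex.addHaar_frontier volume (convex_convexHull ℝ _), add_zero]

/-- The left side of a tangent is a closed half-plane; containing the curve, it contains the closed
hull. -/
theorem hull_tangent (hΘ : Monotone Θ) (h0 : ∀ t, 0 ≤ Θ t) (h2 : ∀ t, Θ t ≤ 2 * π)
    (h1 : arc Θ 1 = 0) {s : ℝ} (hs : s ∈ Icc (0 : ℝ) 1) {z : ℂ} (hz : z ∈ hull Θ) :
    Real.sin (Θ s) * (z.re - (arc Θ s).re) ≤ Real.cos (Θ s) * (z.im - (arc Θ s).im) := by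
  have := hull_subset_halfPlane (a := Real.cos (Θ s)) (b := -Real.sin (Θ s))
    (c := Real.cos (Θ s) * (arc Θ s).im - Real.sin (Θ s) * (arc Θ s).re) (fun t ht => ?_) hz
  · linarith
  · have := integral_sin_sub_nonneg hΘ h0 h2 h1 hs ht
    rw [integral_sin_sub hΘ] at this
    linarith

/-- The curve rises until `τ` and falls afterwards. Nothing is claimed at `τ` itself, where `Θ` may
jump across `π`. -/
theorem exists_le_pi_ge_pi (hΘ : Monotone Θ) :
    ∃ τ ∈ Icc (0 : ℝ) 1, (∀ t, 0 < t → t < τ → Θ t ≤ π) ∧ ∀ t, τ < t → t ≤ 1 → π ≤ Θ t := by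
  -- Inserting `0` keeps the set nonempty when `Θ > π` on the whole unit interval.
  set S : Set ℝ := insert 0 {t | t ∈ Icc (0 : ℝ) 1 ∧ Θ t ≤ π}
  have hS : ∀ t ∈ S, t ∈ Icc (0 : ℝ) 1 := by
    rintro t (rfl | ht)
    · simp
    · exact ht.1
  have hb : BddAbove S := ⟨1, fun t ht => (hS t ht).2⟩
  have hne : S.Nonempty := ⟨0, mem_insert _ _⟩
  refine ⟨sSup S, ⟨le_csSup hb (mem_insert _ _), csSup_le hne fun t ht => (hS t ht).2⟩, ?_, ?_⟩
  · intro t ht htS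
    obtain ⟨u, hu, htu⟩ := exists_lt_of_lt_csSup hne htS
    rcases hu with rfl | hu
    · linarith
    · exact (hΘ htu.le).trans hu.2
  · intro t ht ht1
    by_contra hlt
    have : t ∈ S := Or.inr ⟨⟨(le_csSup hb (mem_insert _ _)).trans ht.le, ht1⟩, (not_le.1 hlt).le⟩
    exact absurd (le_csSup hb this) (not_le.2 ht)

/-- The fundamental theorem of calculus; a monotone `Θ` is continuous off a countable set. -/
theorem hasDerivAt_im_arc (hΘ : Monotone Θ) {t : ℝ} (ht : ContinuousAt Θ t) :
    HasDerivAt (fun t => (arc Θ t).im) (Real.sin (Θ t)) t := by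
  simp only [im_arc hΘ]
  have := hΘ.measurable
  refine intervalIntegral.integral_hasDerivAt_right (intervalIntegrable_sin' hΘ _ _) ?_
    (Real.continuous_sin.continuousAt.comp ht)
  exact (Measurable.stronglyMeasurable (by fun_prop)).stronglyMeasurableAtFilter

end Arc

/-! ### Integration by height, and horizontal slices. -/

/-- Change of variables along a monotone function that is differentiable off a countable set. -/
theorem integral_comp_of_monotoneOn {a b H : ℝ} (hab : a ≤ b) {Y φ X g : ℝ → ℝ} {N : Set ℝ}
    (hN : N.Countable) (hY : ContinuousOn Y (Icc a b)) (hmono : MonotoneOn Y (Icc a b))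
    (hYa : Y a = 0) (hYb : Y b = H) (hd : ∀ t ∈ Ioo a b \ N, HasDerivAt Y (φ t) t)
    (hg : ∀ t ∈ Ioo a b, 0 < Y t → Y t < H → g (Y t) = X t)
    (hint : IntervalIntegrable (fun t => X t * φ t) volume a b) :
    IntegrableOn g (Ioo 0 H) ∧ ∫ y in Ioo 0 H, g y = ∫ t in a..b, X t * φ t := by
  set S := Ioo a b \ N
  set S' := S ∩ Y ⁻¹' Ioo 0 H
  have hSm : MeasurableSet S := measurableSet_Ioo.diff hN.measurableSet
  have hcS : ContinuousOn Y S := hY.mono fun t ht => Ioo_subset_Icc_self ht.1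
  have hS'm : MeasurableSet S' := by
    obtain ⟨U, hU, hUe⟩ := continuousOn_iff'.1 hcS (Ioo 0 H) isOpen_Ioo
    have : S' = U ∩ S := by rw [← hUe, inter_comm]
    rw [this]
    exact hU.measurableSet.inter hSm
  have hS'sub : S' ⊆ Icc a b := fun t ht => Ioo_subset_Icc_self ht.1.1
  have hd' : ∀ t ∈ S', HasDerivWithinAt Y (φ t) S' t := fun t ht => (hd t ht.1).hasDerivWithinAt
  have hm' : MonotoneOn Y S' := hmono.mono hS'sub
  have himg1 : Y '' S' ⊆ Ioo 0 H := by rintro _ ⟨t, ht, rfl⟩; exact ht.2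
  have himg2 : Ioo 0 H ⊆ Y '' S' ∪ Y '' N := by
    intro y hy
    obtain ⟨t, ht, rfl⟩ := intermediate_value_Ioo hab hY (by rwa [hYa, hYb])
    by_cases htN : t ∈ N
    · exact Or.inr ⟨t, htN, rfl⟩
    · exact Or.inl ⟨t, ⟨⟨ht, htN⟩, hy⟩, rfl⟩
  -- The heights missed lie in the image of the countable set `N`, hence form a null set.
  have hae : (Y '' S' : Set ℝ) =ᵐ[volume] Ioo 0 H := by
    refine himg1.eventuallyLE.antisymm ?_
    have hz : volume (Y '' N) = 0 := (hN.image Y).measure_zero _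
    rw [ae_le_set]
    refine measure_mono_null ?_ hz
    rintro y ⟨hy, hy'⟩
    exact (himg2 hy).resolve_left hy'
  -- At the extreme heights `0` and `H` the function `Y` has a local extremum, so the discarded
  -- times contribute nothing to the integral.
  have hzero : ∀ t ∈ S, t ∉ S' → φ t = 0 := by
    intro t ht ht'
    have h1 : a ∈ Icc a b := left_mem_Icc.2 hab
    have h2 : b ∈ Icc a b := right_mem_Icc.2 hab
    have hnb : Icc a b ∈ nhds t := Icc_mem_nhds ht.1.1 ht.1.2
    have hge : ∀ u ∈ Icc a b, 0 ≤ Y u := fun u hu => hYa ▸ hmono h1 hu hu.1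
    have hle : ∀ u ∈ Icc a b, Y u ≤ H := fun u hu => hYb ▸ hmono hu h2 hu.2
    have htI := Ioo_subset_Icc_self ht.1
    have : Y t = 0 ∨ Y t = H := by
      by_contra hcon
      rw [not_or] at hcon
      exact ht' ⟨ht, lt_of_le_of_ne (hge t htI) (Ne.symm hcon.1), lt_of_le_of_ne (hle t htI) hcon.2⟩
    rcases this with h | h
    · refine IsLocalMin.hasDerivAt_eq_zero ?_ (hd t ht)
      filter_upwards [hnb] with u hu
      rw [h]; exact hge u hu
    · refine IsLocalMax.hasDerivAt_eq_zero ?_ (hd t ht)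
      filter_upwards [hnb] with u hu
      rw [h]; exact hle u hu
  have hSae : (S : Set ℝ) =ᵐ[volume] Ioc a b := by
    refine (sdiff_null_ae_eq_self (hN.measure_zero _)).trans Ioo_ae_eq_Ioc
  have hcong : ∀ t ∈ S', φ t • g (Y t) = X t * φ t := fun t ht => by
    rw [hg t ht.1.1 ht.2.1 ht.2.2, smul_eq_mul, mul_comm]
  constructor
  · rw [← integrableOn_congr_set_ae hae,
      integrableOn_image_iff_integrableOn_deriv_smul_of_monotoneOn hS'm hd' hm',
      integrableOn_congr_fun hcong hS'm]
    refine ((intervalIntegrable_iff_integrableOn_Ioc_of_le hab).1 hint).mono_set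
      fun t ht => ⟨ht.1.1.1, ht.1.1.2.le⟩
  · rw [← setIntegral_congr_set hae,
      integral_image_eq_integral_deriv_smul_of_monotoneOn hS'm hd' hm',
      setIntegral_congr_fun hS'm hcong, intervalIntegral.integral_of_le hab,
      ← setIntegral_congr_set hSae]
    refine (setIntegral_eq_of_subset_of_forall_sdiff_eq_zero hSm inter_subset_left ?_).symm
    intro t ht
    rw [hzero t ht.1 ht.2, mul_zero]

/-- The part of `C` at height `y`. -/
def slice (C : Set ℂ) (y : ℝ) : Set ℝ := {x : ℝ | (⟨x, y⟩ : ℂ) ∈ C}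

theorem volume_eq_lintegral_slice {C : Set ℂ} (hC : MeasurableSet C) :
    volume C = ∫⁻ y, volume (slice C y) := by
  rw [← (Complex.volume_preserving_equiv_real_prod.symm).measure_preimage hC.nullMeasurableSet,
    Measure.volume_eq_prod, Measure.prod_apply_symm (Complex.measurableEquivRealProd.symm.measurable hC)]
  rfl

theorem slice_eq_Icc {C : Set ℂ} (hC : Convex ℝ C) {y l r : ℝ} (hl : IsLeast (slice C y) l)
    (hr : IsGreatest (slice C y) r) : slice C y = Icc l r := by
  refine Subset.antisymm (fun x hx => ⟨hl.2 hx, hr.2 hx⟩) fun x hx => ?_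
  obtain ⟨p, q, hp, hq, hpq, rfl⟩ := (by
    rw [segment_eq_Icc (hx.1.trans hx.2)]; exact hx : x ∈ segment ℝ l r)
  have := hC hl.1 hr.1 hp hq hpq
  have he : p • (⟨l, y⟩ : ℂ) + q • (⟨r, y⟩ : ℂ) = ⟨p • l + q • r, y⟩ := by
    apply Complex.ext
    · simp
    · simp [← add_mul, hpq]
  rwa [he] at this

/-! ### Green's formula for the area of the hull. -/

section Arc

variable {Θ : ℝ → ℝ}

theorem measurableSet_hull (Θ : ℝ → ℝ) : MeasurableSet (hull Θ) := isClosed_closure.measurableSet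

/-- The area enclosed by a closed convex curve, as a line integral. -/
theorem volume_convexHull_arc (hΘ : Monotone Θ) (h0 : ∀ t, 0 ≤ Θ t) (h2 : ∀ t, Θ t ≤ 2 * π)
    (h1 : arc Θ 1 = 0) : volume (convexHull ℝ (arc Θ '' Icc 0 1)) =
      ENNReal.ofReal (∫ t in (0 : ℝ)..1, (arc Θ t).re * Real.sin (Θ t)) := by
  obtain ⟨τ, hτ, hlo, hhi⟩ := exists_le_pi_ge_pi hΘ
  set X : ℝ → ℝ := fun t => (arc Θ t).re with hX
  set Y : ℝ → ℝ := fun t => (arc Θ t).im with hY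
  have hXc : Continuous X := Complex.continuous_re.comp (continuous_arc hΘ)
  have hYc : Continuous Y := Complex.continuous_im.comp (continuous_arc hΘ)
  have hYsub : ∀ s t, Y t - Y s = ∫ u in s..t, Real.sin (Θ u) := im_arc_sub hΘ
  set H := Y τ with hH
  have hY0 : Y 0 = 0 := by simp [hY, arc_zero]
  have hY1 : Y 1 = 0 := by simp [hY, h1]
  have hmono : MonotoneOn Y (Icc 0 τ) := by
    intro s hs t ht hst
    rw [← sub_nonneg, hYsub, intervalIntegral.integral_of_le hst, integral_Ioc_eq_integral_Ioo]
    exact setIntegral_nonneg measurableSet_Ioo fun u hu => Real.sin_nonneg_of_nonneg_of_le_pi (h0 u)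
      (hlo u (hs.1.trans_lt hu.1) (hu.2.trans_le ht.2))
  have hanti : AntitoneOn Y (Icc τ 1) := by
    intro s hs t ht hst
    rw [← sub_nonpos, hYsub, intervalIntegral.integral_of_le hst, integral_Ioc_eq_integral_Ioo]
    refine setIntegral_nonpos measurableSet_Ioo fun u hu => ?_
    rw [← Real.sin_sub_two_pi]
    exact Real.sin_nonpos_of_nonpos_of_neg_pi_le (by linarith [h2 u])
      (by linarith [hhi u (hs.1.trans_lt hu.1) (hu.2.le.trans ht.2)])
  have hτ0 : (0 : ℝ) ∈ Icc 0 τ := ⟨le_rfl, hτ.1⟩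
  have hττ : τ ∈ Icc 0 τ := ⟨hτ.1, le_rfl⟩
  have hτ1 : (1 : ℝ) ∈ Icc τ 1 := ⟨hτ.2, le_rfl⟩
  have hττ' : τ ∈ Icc τ 1 := ⟨le_rfl, hτ.2⟩
  have hbd : ∀ t ∈ Icc (0 : ℝ) 1, 0 ≤ Y t ∧ Y t ≤ H := by
    intro t ht
    rcases le_total t τ with h | h
    · exact ⟨hY0 ▸ hmono hτ0 ⟨ht.1, h⟩ ht.1, hmono ⟨ht.1, h⟩ hττ h⟩
    · exact ⟨hY1 ▸ hanti ⟨h, ht.2⟩ hτ1 ht.2, hanti hττ' ⟨h, ht.2⟩ h⟩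
  have hI : ∀ a b, IntervalIntegrable (fun t => X t * Real.sin (Θ t)) volume a b := fun a b =>
    (intervalIntegrable_sin' hΘ a b).continuousOn_mul hXc.continuousOn
  -- On the rising branch `sin (Θ t) > 0`, and for a point at the same height the tangent inequality
  -- reduces to `sin (Θ t) * (x - X t) ≤ 0`. Angles `0` and `π` are excluded because they would
  -- force height `0` or `H`.
  have hright : ∀ t ∈ Ioo 0 τ, 0 < Y t → Y t < H → IsGreatest (slice (hull Θ) (Y t)) (X t) := by
    intro t ht hYt hYtH
    have htI : t ∈ Icc (0 : ℝ) 1 := ⟨ht.1.le, ht.2.le.trans hτ.2⟩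
    refine ⟨arc_mem_hull htI, fun x hx => ?_⟩
    have := hull_tangent hΘ h0 h2 h1 htI hx
    simp only [hY, sub_self, mul_zero] at this
    have hpos : 0 < Θ t := by
      by_contra hcon
      have : Y t - Y 0 = 0 := by
        rw [hYsub, intervalIntegral.integral_of_le ht.1.le]
        refine setIntegral_eq_zero_of_forall_eq_zero fun u hu => ?_
        have : Θ u = 0 := le_antisymm ((hΘ hu.2).trans (not_lt.1 hcon)) (h0 u)
        rw [this, Real.sin_zero]
      linarith
    have hpi : Θ t < π := by
      by_contra hcon
      have : Y τ - Y t = 0 := by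
        rw [hYsub, intervalIntegral.integral_of_le ht.2.le, integral_Ioc_eq_integral_Ioo]
        refine setIntegral_eq_zero_of_forall_eq_zero fun u hu => ?_
        have : Θ u = π := le_antisymm (hlo u (ht.1.trans hu.1) hu.2)
          ((not_lt.1 hcon).trans (hΘ hu.1.le))
        rw [this, Real.sin_pi]
      linarith
    have := nonpos_of_mul_nonpos_right this (Real.sin_pos_of_pos_of_lt_pi hpos hpi)
    simp only [hX]; linarith
  -- On the falling branch the sine is negative, so the same inequality makes the curve point
  -- leftmost.
  have hleft : ∀ t ∈ Ioo τ 1, 0 < Y t → Y t < H → IsLeast (slice (hull Θ) (Y t)) (X t) := by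
    intro t ht hYt hYtH
    have htI : t ∈ Icc (0 : ℝ) 1 := ⟨hτ.1.trans ht.1.le, ht.2.le⟩
    refine ⟨arc_mem_hull htI, fun x hx => ?_⟩
    have := hull_tangent hΘ h0 h2 h1 htI hx
    simp only [hY, sub_self, mul_zero] at this
    have hpos : π < Θ t := by
      by_contra hcon
      have : Y t - Y τ = 0 := by
        rw [hYsub, intervalIntegral.integral_of_le ht.1.le]
        refine setIntegral_eq_zero_of_forall_eq_zero fun u hu => ?_
        have : Θ u = π := le_antisymm ((hΘ hu.2).trans (not_lt.1 hcon))
          (hhi u hu.1 (hu.2.trans ht.2.le))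
        rw [this, Real.sin_pi]
      linarith
    have hpi : Θ t < 2 * π := by
      by_contra hcon
      have : Y 1 - Y t = 0 := by
        rw [hYsub, intervalIntegral.integral_of_le ht.2.le]
        refine setIntegral_eq_zero_of_forall_eq_zero fun u hu => ?_
        have : Θ u = 2 * π := le_antisymm (h2 u) ((not_lt.1 hcon).trans (hΘ hu.1.le))
        rw [this, Real.sin_two_pi]
      linarith
    have hs : Real.sin (Θ t) < 0 := by
      rw [← Real.sin_sub_two_pi]
      exact Real.sin_neg_of_neg_of_neg_pi_lt (by linarith) (by linarith)
    have := nonneg_of_mul_nonpos_right this hs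
    simp only [hX]; linarith
  obtain ⟨hri, hr⟩ := integral_comp_of_monotoneOn hτ.1 hΘ.countable_not_continuousAt
    hYc.continuousOn hmono hY0 hH.symm (g := fun y => sSup (slice (hull Θ) y))
    (fun t ht => hasDerivAt_im_arc hΘ (not_not.1 ht.2))
    (fun t ht h h' => (hright t ht h h').csSup_eq) (hI 0 τ)
  have hneg : ∀ t, t ∈ Icc (-1) (-τ) → -t ∈ Icc τ 1 := fun t ht => ⟨by linarith [ht.2], by linarith [ht.1]⟩
  -- Reversing time makes the falling branch monotone increasing; the sign of `sin` changes
  -- accordingly.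
  obtain ⟨hli, hl⟩ := integral_comp_of_monotoneOn (a := -1) (b := -τ) (Y := fun t => Y (-t))
    (φ := fun t => -Real.sin (Θ (-t))) (X := fun t => X (-t)) (H := H)
    (N := Neg.neg ⁻¹' {t | ¬ ContinuousAt Θ t}) (neg_le_neg hτ.2)
    (hΘ.countable_not_continuousAt.preimage neg_injective)
    (by fun_prop) (fun s hs t ht hst => hanti (hneg t ht) (hneg s hs) (neg_le_neg hst))
    (by simpa using hY1) (by simp [hH]) (g := fun y => sInf (slice (hull Θ) y))
    (fun t ht => by
      have h3 := (hasDerivAt_im_arc hΘ (not_not.1 ht.2)).scomp t (hasDerivAt_neg t)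
      simpa [Function.comp_def] using h3)
    (fun t ht h h' => (hleft (-t) ⟨by linarith [ht.2], by linarith [ht.1]⟩ h h').csInf_eq)
    (by
      have := hΘ.measurable
      refine IntervalIntegrable.continuousOn_mul (intervalIntegrable_of_bounded 1
        (Measurable.aestronglyMeasurable (by fun_prop)) (fun t => ?_) _ _) (by fun_prop)
      rw [norm_neg]
      exact Real.abs_sin_le_one _)
  have hl' : ∫ t in (-1)..(-τ), X (-t) * -Real.sin (Θ (-t)) =
      -∫ t in τ..1, X t * Real.sin (Θ t) := by
    rw [intervalIntegral.integral_comp_neg (fun t => X t * -Real.sin (Θ t))]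
    simp
  have hslice : ∀ y ∈ Ioo 0 H, volume (slice (hull Θ) y) =
      ENNReal.ofReal (sSup (slice (hull Θ) y) - sInf (slice (hull Θ) y)) := by
    intro y hy
    obtain ⟨t, ht, rfl⟩ := intermediate_value_Ioo hτ.1 hYc.continuousOn (by rwa [hY0])
    obtain ⟨t', ht', he⟩ := intermediate_value_Ioo' hτ.2 hYc.continuousOn (by rwa [hY1])
    have hg := hright t ht hy.1 hy.2
    have hle := hleft t' ht' (by rw [he]; exact hy.1) (by rw [he]; exact hy.2)
    rw [he] at hle
    rw [hg.csSup_eq, hle.csInf_eq, slice_eq_Icc (convex_hull Θ) hle hg, Real.volume_Icc]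
  have hout : ∀ y, y ∉ Icc 0 H → volume (slice (hull Θ) y) = 0 := by
    intro y hy
    have : slice (hull Θ) y = ∅ := by
      refine eq_empty_of_forall_notMem fun x hx => hy ⟨?_, ?_⟩
      · simpa using hull_subset_halfPlane (a := 1) (b := 0) (c := 0)
          (fun t ht => by simpa using (hbd t ht).1) hx
      · simpa using hull_subset_halfPlane (a := -1) (b := 0) (c := -H)
          (fun t ht => by simpa using (hbd t ht).2) hx
    rw [this, measure_empty]
  have hle : ∀ y ∈ Ioo 0 H, 0 ≤ sSup (slice (hull Θ) y) - sInf (slice (hull Θ) y) := by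
    intro y hy
    obtain ⟨t, ht, rfl⟩ := intermediate_value_Ioo hτ.1 hYc.continuousOn (by rwa [hY0])
    obtain ⟨t', ht', he⟩ := intermediate_value_Ioo' hτ.2 hYc.continuousOn (by rwa [hY1])
    have hg := hright t ht hy.1 hy.2
    have hle := hleft t' ht' (by rw [he]; exact hy.1) (by rw [he]; exact hy.2)
    rw [he] at hle
    rw [hg.csSup_eq, hle.csInf_eq]
    exact sub_nonneg.2 (hle.2 hg.1)
  -- Area is the integral of slice lengths. The end heights `0` and `H`, where the slice may be a
  -- whole edge, are dropped as null.
  rw [← volume_hull, volume_eq_lintegral_slice (measurableSet_hull Θ),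
    ← setLIntegral_eq_of_support_subset (s := Icc 0 H) , setLIntegral_congr Ioo_ae_eq_Icc.symm,
    setLIntegral_congr_fun measurableSet_Ioo hslice,
    ← ofReal_integral_eq_lintegral_ofReal
      (f := fun y => sSup (slice (hull Θ) y) - sInf (slice (hull Θ) y)) (hri.sub hli), integral_sub hri hli, hr, hl, hl',
    sub_neg_eq_add, intervalIntegral.integral_add_adjacent_intervals (hI _ _) (hI _ _)]
  · exact (ae_restrict_iff' measurableSet_Ioo).2 (Filter.Eventually.of_forall hle)
  · intro y hy
    by_contra hcon
    exact hy (hout y hcon)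

end Arc

/-! ### From the line integral to a double integral over the unit square. -/

section LineIntegral

variable {Θ : ℝ → ℝ}

/-- Each vertical fibre of the diagonal is a point; so the two open triangles fill the square almost
everywhere. -/
theorem measure_diagonal (m : Measure ℝ) [SFinite m] [NullSingletonClass m] :
    ∀ᵐ z : ℝ × ℝ ∂m.prod m, z.2 ≠ z.1 := by
  have h : MeasurableSet {z : ℝ × ℝ | z.2 = z.1} := measurableSet_eq_fun measurable_snd measurable_fst
  rw [ae_iff]
  simp only [ne_eq, not_not]
  rw [Measure.measure_prod_null h]
  refine Filter.Eventually.of_forall fun x => ?_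
  have : Prod.mk x ⁻¹' {z : ℝ × ℝ | z.2 = z.1} = {x} := by ext; simp
  simp only [this, measure_singleton, Pi.zero_apply]

theorem integral_swap (m : Measure ℝ) [SFinite m] (f : ℝ × ℝ → ℝ) :
    ∫ z, f z.swap ∂m.prod m = ∫ z, f z ∂m.prod m := integral_prod_swap f

/-- The law of a uniform variable on the unit interval. -/
noncomputable abbrev unitLaw : Measure ℝ := volume.restrict (Ioc 0 1)

instance : IsProbabilityMeasure unitLaw := ⟨by simp⟩

theorem integrable_of_bounded {α : Type*} [MeasurableSpace α] {m : Measure α} [IsFiniteMeasure m]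
    {E : Type*} [NormedAddCommGroup E] {f : α → E} (C : ℝ)
    (hf : AEStronglyMeasurable f m) (hC : ∀ x, ‖f x‖ ≤ C) : Integrable f m :=
  Integrable.of_bound hf C (Filter.Eventually.of_forall hC)

theorem integral_cos_unitLaw (hΘ : Monotone Θ) (h1 : arc Θ 1 = 0) :
    ∫ s, Real.cos (Θ s) ∂unitLaw = 0 := by
  rw [← intervalIntegral.integral_of_le zero_le_one, ← re_arc hΘ, h1, Complex.zero_re]

theorem integral_sin_unitLaw (hΘ : Monotone Θ) (h1 : arc Θ 1 = 0) :
    ∫ s, Real.sin (Θ s) ∂unitLaw = 0 := by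
  rw [← intervalIntegral.integral_of_le zero_le_one, ← im_arc hΘ, h1, Complex.zero_im]

theorem integral_re_mul_sin_eq_prod (hΘ : Monotone Θ) :
    ∫ t in (0 : ℝ)..1, (arc Θ t).re * Real.sin (Θ t) =
      ∫ z, {z : ℝ × ℝ | z.2 < z.1}.indicator
        (fun z => Real.cos (Θ z.2) * Real.sin (Θ z.1)) z ∂unitLaw.prod unitLaw := by
  have hm := hΘ.measurable
  have hD : MeasurableSet {z : ℝ × ℝ | z.2 < z.1} := measurableSet_lt measurable_snd measurable_fst
  rw [integral_prod _ (integrable_of_bounded 1 (Measurable.aestronglyMeasurable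
    (Measurable.indicator (by fun_prop) hD)) fun z => ?_),
    intervalIntegral.integral_of_le zero_le_one]
  · refine setIntegral_congr_fun measurableSet_Ioc fun t ht => ?_
    rw [re_arc hΘ, intervalIntegral.integral_of_le ht.1.le, integral_Ioc_eq_integral_Ioo,
      ← integral_mul_const, ← integral_indicator measurableSet_Ioo,
      ← integral_indicator measurableSet_Ioc]
    refine integral_congr_ae (Filter.Eventually.of_forall fun s => ?_)
    simp only [indicator, mem_Ioo, mem_Ioc, mem_ofPred_eq]
    by_cases h : 0 < s ∧ s < t
    · rw [if_pos h, if_pos ⟨h.1, h.2.le.trans ht.2⟩, if_pos h.2]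
    · rw [if_neg h]
      split_ifs with h3 h4
      · exact absurd ⟨h3.1, h4⟩ h
      · rfl
      · rfl
  · refine (norm_indicator_le_norm_self _ _).trans ?_
    rw [norm_mul]
    exact mul_le_one₀ (Real.abs_cos_le_one _) (norm_nonneg _) (Real.abs_sin_le_one _)

theorem integral_sin_abs (hΘ : Monotone Θ) (h1 : arc Θ 1 = 0) :
    ∫ z, Real.sin |Θ z.1 - Θ z.2| ∂unitLaw.prod unitLaw =
      4 * ∫ t in (0 : ℝ)..1, (arc Θ t).re * Real.sin (Θ t) := by
  have hm := hΘ.measurable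
  set D : Set (ℝ × ℝ) := {z | z.2 < z.1} with hDdef
  have hD : MeasurableSet D := measurableSet_lt measurable_snd measurable_fst
  set f : ℝ × ℝ → ℝ := fun z => Real.cos (Θ z.2) * Real.sin (Θ z.1) with hf
  have hfm : Measurable f := by fun_prop
  have hfb : ∀ z, ‖f z‖ ≤ 1 := fun z => by
    rw [hf, norm_mul]
    exact mul_le_one₀ (Real.abs_cos_le_one _) (norm_nonneg _) (Real.abs_sin_le_one _)
  -- By the addition formula `sin |Θ z.1 - Θ z.2|` is `g₁ - g₂` on one triangle and its reflection
  -- on the other, so its integral is `2 (∫ g₁ - ∫ g₂)`.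
  set g₁ : ℝ × ℝ → ℝ := D.indicator f
  set g₂ : ℝ × ℝ → ℝ := D.indicator fun z => f z.swap
  have hi : ∀ g : ℝ × ℝ → ℝ, Measurable g → (∀ z, ‖g z‖ ≤ 1) →
      Integrable g (unitLaw.prod unitLaw) := fun g hg hb =>
    integrable_of_bounded 1 hg.aestronglyMeasurable hb
  have hm₁ : Measurable g₁ := hfm.indicator hD
  have hm₂ : Measurable g₂ := (hfm.comp measurable_swap).indicator hD
  have hb₁ : ∀ z, ‖g₁ z‖ ≤ 1 := fun z => (norm_indicator_le_norm_self _ _).trans (hfb z)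
  have hb₂ : ∀ z, ‖g₂ z‖ ≤ 1 := fun z => (norm_indicator_le_norm_self _ _).trans (hfb z.swap)
  have i₁ := hi g₁ hm₁ hb₁
  have i₂ := hi g₂ hm₂ hb₂
  have i₁' := hi (fun z => g₁ z.swap) (hm₁.comp measurable_swap) fun z => hb₁ _
  have i₂' := hi (fun z => g₂ z.swap) (hm₂.comp measurable_swap) fun z => hb₂ _
  have hsplit : ∀ z : ℝ × ℝ, Real.sin |Θ z.1 - Θ z.2| =
      (g₁ z - g₂ z) + (g₁ z.swap - g₂ z.swap) := by
    intro z
    simp only [g₁, g₂, hf, hDdef, indicator, mem_ofPred_eq, Prod.fst_swap, Prod.snd_swap]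
    rcases lt_trichotomy z.2 z.1 with h | h | h
    · rw [abs_of_nonneg (sub_nonneg.2 (hΘ h.le)), Real.sin_sub, if_pos h, if_pos h,
        if_neg h.not_gt, if_neg h.not_gt]
      ring
    · simp [h]
    · rw [abs_of_nonpos (sub_nonpos.2 (hΘ h.le)), neg_sub, Real.sin_sub, if_pos h, if_pos h,
        if_neg h.not_gt, if_neg h.not_gt]
      ring
  -- Reflecting `g₂` completes `g₁` to `f` on the whole square, where the integral factorises into
  -- the vanishing means of `sin Θ` and `cos Θ`. Thus `∫ g₂ = -∫ g₁`, whence the factor `4`.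
  have hzero : ∫ z, g₁ z ∂unitLaw.prod unitLaw + ∫ z, g₂ z ∂unitLaw.prod unitLaw = 0 := by
    rw [← integral_swap unitLaw g₂, ← integral_add i₁ i₂']
    have : ∫ z, f z ∂unitLaw.prod unitLaw = 0 := by
      have := integral_prod_mul (μ := unitLaw) (ν := unitLaw) (fun t => Real.sin (Θ t))
        (fun t => Real.cos (Θ t))
      rw [integral_sin_unitLaw hΘ h1, zero_mul] at this
      simpa only [hf, mul_comm (Real.cos _)] using this
    rw [← this]
    refine integral_congr_ae ?_
    filter_upwards [measure_diagonal unitLaw] with z hz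
    simp only [g₁, g₂, hDdef, indicator, mem_ofPred_eq, Prod.fst_swap, Prod.snd_swap]
    rcases hz.lt_or_gt with h | h
    · rw [if_pos h, if_neg h.not_gt, add_zero]
    · rw [if_neg h.not_gt, if_pos h, zero_add]
      rfl
  have hP := integral_re_mul_sin_eq_prod hΘ
  simp_rw [hsplit]
  have j : Integrable (fun z => g₁ z - g₂ z) (unitLaw.prod unitLaw) := i₁.sub i₂
  have j' : Integrable (fun z : ℝ × ℝ => g₁ z.swap - g₂ z.swap) (unitLaw.prod unitLaw) := i₁'.sub i₂'
  rw [integral_add j j', integral_sub i₁ i₂, integral_sub i₁' i₂',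
    integral_swap unitLaw g₁, integral_swap unitLaw g₂, hP]
  change _ = 4 * ∫ z, g₁ z ∂unitLaw.prod unitLaw
  linarith

/-- After expansion each term is a product of functions of one variable, one factor being `sin Θ` or
`cos Θ`, of mean zero. -/
theorem integral_sub_mul_sin_sub (hΘ : Monotone Θ) (h0 : ∀ t, 0 ≤ Θ t) (h2 : ∀ t, Θ t ≤ 2 * π)
    (h1 : arc Θ 1 = 0) :
    ∫ z, (Θ z.1 - Θ z.2) * Real.sin (Θ z.1 - Θ z.2) ∂unitLaw.prod unitLaw = 0 := by
  have hm := hΘ.measurable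
  have hs := integral_sin_unitLaw hΘ h1
  have hc := integral_cos_unitLaw hΘ h1
  have hb : ∀ t u, ‖Θ t * Real.sin u‖ ≤ 2 * π := fun t u => by
    rw [norm_mul, Real.norm_of_nonneg (h0 t)]
    calc Θ t * ‖Real.sin u‖ ≤ Θ t * 1 := by gcongr; exacts [h0 t, Real.abs_sin_le_one u]
      _ ≤ 2 * π := by linarith [h2 t]
  have hb' : ∀ t u, ‖Θ t * Real.cos u‖ ≤ 2 * π := fun t u => by
    simpa [Real.sin_add_pi_div_two] using hb t (u + π / 2)
  have bd : ∀ {f g : ℝ → ℝ}, Measurable f → Measurable g → (∀ t, ‖f t‖ ≤ 2 * π) →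
      (∀ t, ‖g t‖ ≤ 1) → Integrable (fun z : ℝ × ℝ => f z.1 * g z.2) (unitLaw.prod unitLaw) ∧
      Integrable (fun z : ℝ × ℝ => g z.1 * f z.2) (unitLaw.prod unitLaw) := by
    intro f g hf hg hfb hgb
    have key : ∀ t u, ‖f t * g u‖ ≤ 2 * π := fun t u => by
      rw [norm_mul]
      calc ‖f t‖ * ‖g u‖ ≤ 2 * π * 1 :=
            mul_le_mul (hfb t) (hgb u) (norm_nonneg _) Real.two_pi_pos.le
        _ = 2 * π := mul_one _
    exact ⟨integrable_of_bounded (2 * π) (Measurable.aestronglyMeasurable (by fun_prop))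
      fun z => key _ _, integrable_of_bounded (2 * π) (Measurable.aestronglyMeasurable (by fun_prop))
      fun z => by rw [mul_comm]; exact key _ _⟩
  have e1 := bd (f := fun t => Θ t * Real.sin (Θ t)) (g := fun t => Real.cos (Θ t)) (by fun_prop)
    (by fun_prop) (fun t => hb t _) (fun t => Real.abs_cos_le_one _)
  have e2 := bd (f := fun t => Θ t * Real.cos (Θ t)) (g := fun t => Real.sin (Θ t)) (by fun_prop)
    (by fun_prop) (fun t => hb' t _) (fun t => Real.abs_sin_le_one _)
  have hexp : ∀ z : ℝ × ℝ, (Θ z.1 - Θ z.2) * Real.sin (Θ z.1 - Θ z.2) =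
      ((Θ z.1 * Real.sin (Θ z.1)) * Real.cos (Θ z.2) + Real.cos (Θ z.1) * (Θ z.2 * Real.sin (Θ z.2)))
      - ((Θ z.1 * Real.cos (Θ z.1)) * Real.sin (Θ z.2) +
        Real.sin (Θ z.1) * (Θ z.2 * Real.cos (Θ z.2))) := fun z => by
    rw [Real.sin_sub]; ring
  simp_rw [hexp]
  have j1 : Integrable (fun z : ℝ × ℝ => (Θ z.1 * Real.sin (Θ z.1)) * Real.cos (Θ z.2) +
      Real.cos (Θ z.1) * (Θ z.2 * Real.sin (Θ z.2))) (unitLaw.prod unitLaw) := e1.1.add e1.2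
  have j2 : Integrable (fun z : ℝ × ℝ => (Θ z.1 * Real.cos (Θ z.1)) * Real.sin (Θ z.2) +
      Real.sin (Θ z.1) * (Θ z.2 * Real.cos (Θ z.2))) (unitLaw.prod unitLaw) := e2.1.add e2.2
  rw [integral_sub j1 j2, integral_add e1.1 e1.2, integral_add e2.1 e2.2,
    integral_prod_mul (fun t => Θ t * Real.sin (Θ t)) (fun t => Real.cos (Θ t)),
    integral_prod_mul (fun t => Real.cos (Θ t)) (fun t => Θ t * Real.sin (Θ t)),
    integral_prod_mul (fun t => Θ t * Real.cos (Θ t)) (fun t => Real.sin (Θ t)),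
    integral_prod_mul (fun t => Real.sin (Θ t)) (fun t => Θ t * Real.cos (Θ t)), hs, hc]
  simp

end LineIntegral

/-! ### The periodic kernel and its Fourier series. -/

section Kernel

/-- A fundamental-domain representative of the kernel of the area functional. -/
noncomputable def kernelFun (d : ℝ) : ℂ := (((1 - d / π) * Real.sin d : ℝ) : ℂ)

/-- The kernel of the area functional. -/
noncomputable def kernel : C(Torus, ℂ) where
  toFun := AddCircle.liftIco (2 * π) 0 kernelFun
  continuous_toFun := by
    refine AddCircle.liftIco_zero_continuous (by simp [kernelFun]) (Continuous.continuousOn ?_)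
    unfold kernelFun
    fun_prop

/-- For `d < 0`, shifting by `2π` turns `1 - d / π` into `-1 - d / π`, which accounts for the
absolute value. The range `|d| ≤ 2π` covers all differences of tangent angles. -/
theorem kernel_coe {d : ℝ} (hd : |d| ≤ 2 * π) :
    kernel (d : Torus) = ((Real.sin |d| - d * Real.sin d / π : ℝ) : ℂ) := by
  have hπ := Real.pi_pos.ne'
  have h0 : ∀ x, x ∈ Ico 0 (2 * π) → kernel (x : Torus) = kernelFun x := fun x hx =>
    AddCircle.liftIco_zero_coe_apply (f := kernelFun) hx
  rcases le_or_gt 0 d with h | h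
  · rw [abs_of_nonneg h] at hd ⊢
    rcases hd.lt_or_eq with h3 | h3
    · rw [h0 d ⟨h, h3⟩, kernelFun]
      congr 1
      ring
    · subst h3
      rw [AddCircle.coe_period, ← AddCircle.coe_zero, h0 0 ⟨le_rfl, Real.two_pi_pos⟩, kernelFun]
      simp
  · rw [abs_of_neg h] at hd ⊢
    rcases hd.lt_or_eq with h3 | h3
    · have := h0 (d + 2 * π) ⟨by linarith, by linarith⟩
      rw [AddCircle.coe_add_period] at this
      rw [this, kernelFun, Real.sin_add_two_pi, Real.sin_neg]
      congr 1
      field_simp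
      ring
    · have : d = -(2 * π) := by linarith
      subst this
      rw [AddCircle.coe_neg, AddCircle.coe_period, neg_zero, ← AddCircle.coe_zero,
        h0 0 ⟨le_rfl, Real.two_pi_pos⟩, kernelFun]
      simp

/-- Integration by parts: the exponential is `1` at both ends, and the linear factor drops from `1`
to `-1`. -/
theorem integral_linear_mul_exp {m : ℤ} (hm : m ≠ 0) :
    ∫ x in (0 : ℝ)..2 * π, (1 - (x : ℂ) / π) * Complex.exp (Complex.I * m * x) =
      -2 / (Complex.I * m) := by
  have hπ : (π : ℂ) ≠ 0 := by exact_mod_cast Real.pi_pos.ne'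
  have hm' : Complex.I * (m : ℂ) ≠ 0 := mul_ne_zero Complex.I_ne_zero (by exact_mod_cast hm)
  have hd : ∀ x : ℝ, HasDerivAt (fun x : ℝ => (1 - (x : ℂ) / π) *
      Complex.exp (Complex.I * m * x) / (Complex.I * m) +
        Complex.exp (Complex.I * m * x) / (π * (Complex.I * m) ^ 2))
      ((1 - (x : ℂ) / π) * Complex.exp (Complex.I * m * x)) x := by
    intro x
    have h1 : HasDerivAt (fun x : ℝ => (x : ℂ)) 1 x := Complex.ofRealCLM.hasDerivAt
    have h2 : HasDerivAt (fun x : ℝ => Complex.exp (Complex.I * m * x))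
        (Complex.exp (Complex.I * m * x) * (Complex.I * m * 1)) x :=
      (h1.const_mul (Complex.I * (m : ℂ))).cexp
    have h3 := ((((h1.div_const (π : ℂ)).const_sub 1).mul h2).div_const (Complex.I * m)).add
      (h2.div_const (π * (Complex.I * m) ^ 2))
    refine h3.congr_deriv ?_
    have hm'' := right_ne_zero_of_mul hm'
    field_simp
    ring
  rw [intervalIntegral.integral_eq_sub_of_hasDerivAt (fun x _ => hd x)
    (Continuous.intervalIntegrable (by fun_prop) _ _)]
  have he : Complex.exp (Complex.I * m * ((2 * π : ℝ) : ℂ)) = 1 := by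
    rw [Complex.exp_eq_one_iff]
    exact ⟨m, by push_cast; ring⟩
  rw [he]
  simp only [Complex.ofReal_zero, mul_zero, Complex.exp_zero]
  push_cast
  field_simp
  ring

/-- Splitting the sine leaves the frequencies `1 - n` and `-1 - n`, both nonzero for `n ≠ ±1`. -/
theorem fourierCoeff_kernel {n : ℤ} (h1 : n ≠ 1) (h2 : n ≠ -1) :
    fourierCoeff kernel n = ((-1 / (π * ((n : ℝ) ^ 2 - 1)) : ℝ) : ℂ) := by
  have hπ : (π : ℂ) ≠ 0 := by exact_mod_cast Real.pi_pos.ne'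
  have hk : ∀ x : ℝ, fourier (-n) ((x : ℝ) : AddCircle (0 + 2 * π - 0)) • kernelFun x =
      1 / (2 * Complex.I) * ((1 - (x : ℂ) / π) * Complex.exp (Complex.I * ((1 - n : ℤ) : ℂ) * x)
        - (1 - (x : ℂ) / π) * Complex.exp (Complex.I * ((-1 - n : ℤ) : ℂ) * x)) := by
    intro x
    have e1 : Complex.exp (Complex.I * ((1 - n : ℤ) : ℂ) * x) =
        Complex.exp (-(Complex.I * n * x)) * Complex.exp (x * Complex.I) := by
      rw [← Complex.exp_add]; congr 1; push_cast; ring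
    have e2 : Complex.exp (Complex.I * ((-1 - n : ℤ) : ℂ) * x) =
        Complex.exp (-(Complex.I * n * x)) * Complex.exp (-x * Complex.I) := by
      rw [← Complex.exp_add]; congr 1; push_cast; ring
    have e3 : (fourier (-n) ((x : ℝ) : AddCircle (0 + 2 * π - 0)) : ℂ) =
        Complex.exp (-(Complex.I * n * x)) := by
      rw [fourier_coe_apply]; congr 1; push_cast; field_simp; ring
    rw [e1, e2, e3, kernelFun, smul_eq_mul]
    push_cast
    rw [Complex.sin]
    field_simp
    rw [Complex.I_sq]
    ring
  have hc : fourierCoeff kernel n = fourierCoeffOn (lt_add_of_pos_right 0 Real.two_pi_pos) kernelFun n :=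
    fourierCoeff_liftIco_eq kernelFun n
  have ha : ((1 - n : ℤ) : ℂ) ≠ 0 := by exact_mod_cast sub_ne_zero.2 h1.symm
  have hb : ((-1 - n : ℤ) : ℂ) ≠ 0 := by exact_mod_cast sub_ne_zero.2 h2.symm
  have hI := Complex.I_ne_zero
  rw [hc, fourierCoeffOn_eq_integral]
  simp_rw [hk]
  rw [intervalIntegral.integral_const_mul, intervalIntegral.integral_sub
    (Continuous.intervalIntegrable (by fun_prop) _ _)
    (Continuous.intervalIntegrable (by fun_prop) _ _), zero_add,
    integral_linear_mul_exp (sub_ne_zero.2 h1.symm), integral_linear_mul_exp (sub_ne_zero.2 h2.symm)]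
  have hn : ((n : ℂ) ^ 2 - 1) ≠ 0 := by
    have : ((n : ℂ) ^ 2 - 1) = ((1 - n : ℤ) : ℂ) * ((-1 - n : ℤ) : ℂ) := by push_cast; ring
    rw [this]; exact mul_ne_zero ha hb
  rw [Complex.real_smul]
  push_cast at ha hb ⊢
  field_simp
  rw [Complex.I_sq]
  ring

theorem summable_fourierCoeff_kernel : Summable (fourierCoeff kernel) := by
  have hs : Summable fun n : ℤ => (1 : ℝ) / (n : ℝ) ^ 2 :=
    Real.summable_one_div_int_pow.2 one_lt_two
  refine Summable.of_norm_bounded_eventually (hs.mul_left (2 / π)) ?_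
  have hfin : ({0, 1, -1} : Set ℤ).Finite := by simp
  filter_upwards [hfin.compl_mem_cofinite] with n hn
  simp only [mem_compl_iff, mem_insert_iff, mem_singleton_iff, not_or] at hn
  rw [fourierCoeff_kernel hn.2.1 hn.2.2, Complex.norm_real, Real.norm_eq_abs]
  have h4 : (4 : ℤ) ≤ n ^ 2 := by
    rcases lt_or_gt_of_ne hn.1 with h | h
    · have : n ≤ -2 := by have := hn.2.2; omega
      nlinarith
    · have : 2 ≤ n := by have := hn.2.1; omega
      nlinarith
  have h4' : (4 : ℝ) ≤ (n : ℝ) ^ 2 := by exact_mod_cast h4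
  have hπ := Real.pi_pos
  rw [abs_div, abs_neg, abs_one, abs_of_pos (by nlinarith), div_mul_div_comm, mul_one,
    div_le_div_iff₀ (by nlinarith) (by nlinarith)]
  nlinarith

/-- The energy of a law for the kernel, in terms of Fourier coefficients. -/
theorem hasSum_kernel_energy (μ : Measure Torus) [IsProbabilityMeasure μ] :
    HasSum (fun n : ℤ => fourierCoeff kernel n * ((‖∫ x, fourier n x ∂μ‖ ^ 2 : ℝ) : ℂ))
      (∫ z, kernel (z.1 - z.2) ∂μ.prod μ) := by
  have hF : ∀ n : ℤ, ∀ z : Torus × Torus, fourier n (z.1 - z.2) =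
      fourier n z.1 * (starRingEnd ℂ) (fourier n z.2) := by
    intro n z
    rw [← fourier_neg, fourier_apply, fourier_apply, fourier_apply, smul_sub, neg_smul, sub_eq_add_neg,
      AddCircle.toCircle_add, Circle.coe_mul]
  have hint : ∀ n : ℤ, Integrable (fun z : Torus × Torus => fourierCoeff kernel n •
      fourier n (z.1 - z.2)) (μ.prod μ) := fun n =>
    integrable_of_bounded ‖fourierCoeff kernel n‖
      (Continuous.aestronglyMeasurable (by fun_prop)) fun z => by
        rw [norm_smul, fourier_apply, Circle.norm_coe, mul_one]
  have hn : ∀ n : ℤ, ∫ z : Torus × Torus, ‖fourierCoeff kernel n • fourier n (z.1 - z.2)‖ ∂μ.prod μ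
      = ‖fourierCoeff kernel n‖ := by
    intro n
    simp [fourier_apply, Circle.norm_coe]
  -- Characters are unimodular, so summability of the coefficients allows the sum and the integral
  -- to be exchanged.
  have := hasSum_integral_of_summable_integral_norm hint (by
    simp_rw [hn]; exact summable_fourierCoeff_kernel.norm)
  have e1 : ∀ n : ℤ, ∫ z : Torus × Torus, fourierCoeff kernel n • fourier n (z.1 - z.2) ∂μ.prod μ
      = fourierCoeff kernel n * ((‖∫ x, fourier n x ∂μ‖ ^ 2 : ℝ) : ℂ) := by
    intro n
    rw [integral_smul, smul_eq_mul]
    congr 1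
    simp_rw [hF]
    rw [integral_prod_mul (fun x => (fourier n x : ℂ)) (fun x => (starRingEnd ℂ) (fourier n x)),
      integral_conj, Complex.mul_conj, Complex.normSq_eq_norm_sq]
  have e2 : ∀ z : Torus × Torus, ∑' n : ℤ, fourierCoeff kernel n • fourier n (z.1 - z.2) =
      kernel (z.1 - z.2) := fun z =>
    (has_pointwise_sum_fourier_series_of_summable summable_fourierCoeff_kernel _).tsum_eq
  simpa only [e1, e2] using this

end Kernel

/-! ### The quantile function carries Lebesgue measure to the law. -/

section Quantile

/-- The representative of a point of the circle in `[0, 2π)`. -/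
noncomputable def rep (x : Torus) : ℝ := (AddCircle.measurableEquivIco (2 * π) 0 x : ℝ)

theorem measurable_rep : Measurable rep :=
  measurable_subtype_coe.comp (AddCircle.measurableEquivIco (2 * π) 0).measurable

theorem rep_mem (x : Torus) : rep x ∈ Ico 0 (2 * π) := by
  simpa [rep] using (AddCircle.measurableEquivIco (2 * π) 0 x).2

theorem coe_rep (x : Torus) : ((rep x : ℝ) : Torus) = x :=
  (AddCircle.equivIco (2 * π) 0).symm_apply_apply x

theorem rep_coe {r : ℝ} (hr : r ∈ Ico 0 (2 * π)) : rep (r : Torus) = r :=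
  (AddCircle.coe_eq_coe_iff_of_mem_Ico (p := 2 * π) (a := 0) (by simpa using rep_mem _)
    (by simpa using hr)).1 (coe_rep _)

/-- This identifies `F_μ` with the distribution function of a law on the line, including the range
`x ≥ 2π`. -/
theorem image_coe_Icc {x : ℝ} : (fun y : ℝ => (y : Torus)) '' Icc 0 x = rep ⁻¹' Iic x := by
  ext y
  constructor
  · rintro ⟨r, hr, rfl⟩
    simp only [mem_preimage, mem_Iic]
    rcases lt_or_ge r (2 * π) with h | h
    · rw [rep_coe ⟨hr.1, h⟩]; exact hr.2
    · exact (rep_mem _).2.le.trans (h.trans hr.2)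
  · intro hy
    exact ⟨rep y, ⟨(rep_mem y).1, hy⟩, coe_rep y⟩

variable {μ : Measure Torus} [IsProbabilityMeasure μ]

instance : IsProbabilityMeasure (μ.map rep) :=
  Measure.isProbabilityMeasure_map measurable_rep.aemeasurable

theorem cdf_eq (x : ℝ) : cdf μ x = ProbabilityTheory.cdf (μ.map rep) x := by
  rw [cdf, image_coe_Icc, ProbabilityTheory.cdf_eq_real, map_measureReal_apply measurable_rep measurableSet_Iic]

theorem cdf_two_pi : cdf μ (2 * π) = 1 := by
  have : rep ⁻¹' Iic (2 * π) = univ := eq_univ_of_forall fun x => (rep_mem x).2.le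
  rw [cdf, image_coe_Icc, this, probReal_univ]

theorem cdf_of_neg (μ : Measure Torus) {x : ℝ} (hx : x < 0) : cdf μ x = 0 := by
  simp [cdf, Icc_eq_empty (not_le.2 hx)]

theorem two_pi_mem {y : ℝ} (hy : y ≤ 1) : 2 * π ∈ {x : ℝ | 0 ≤ x ∧ y ≤ cdf μ x} :=
  ⟨Real.two_pi_pos.le, by rwa [cdf_two_pi]⟩

theorem bddBelow_quantile (μ : Measure Torus) (y : ℝ) : BddBelow {x : ℝ | 0 ≤ x ∧ y ≤ cdf μ x} := ⟨0, fun _ hx => hx.1⟩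

/-- Right continuity of the distribution function makes the infimum a minimum. At `y = 0` the
equivalence fails for negative `x`. -/
theorem quantile_le_iff {y : ℝ} (h0 : 0 < y) (h1 : y ≤ 1) (x : ℝ) :
    quantile μ y ≤ x ↔ y ≤ cdf μ x := by
  constructor
  · intro h
    have hq : y ≤ cdf μ (quantile μ y) := by
      rw [cdf_eq]
      have hc := ((ProbabilityTheory.cdf (μ.map rep)).right_continuous (quantile μ y)).tendsto.mono_left
        (nhdsWithin_mono _ Ioi_subset_Ici_self)
      refine ge_of_tendsto hc ?_
      filter_upwards [self_mem_nhdsWithin] with z hz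
      obtain ⟨w, hw, hwz⟩ := exists_lt_of_csInf_lt ⟨2 * π, two_pi_mem h1⟩ hz
      refine hw.2.trans ?_
      rw [cdf_eq]
      exact ProbabilityTheory.monotone_cdf _ hwz.le
    refine hq.trans ?_
    rw [cdf_eq, cdf_eq]
    exact ProbabilityTheory.monotone_cdf _ h
  · intro h
    refine csInf_le (bddBelow_quantile μ y) ⟨?_, h⟩
    by_contra hx
    rw [cdf_of_neg μ (not_le.1 hx)] at h
    linarith

/-- The generalised inverse of the distribution function, continued monotonically beyond `1`. -/
noncomputable def tangentAngle (μ : Measure Torus) (t : ℝ) : ℝ := quantile μ (min t 1)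

theorem monotone_tangentAngle : Monotone (tangentAngle μ) := fun _ _ hst =>
  csInf_le_csInf (bddBelow_quantile μ _) ⟨2 * π, two_pi_mem (min_le_right _ _)⟩
    fun _ hx => ⟨hx.1, (min_le_min_right 1 hst).trans hx.2⟩

theorem tangentAngle_nonneg (μ : Measure Torus) (t : ℝ) : 0 ≤ tangentAngle μ t := Real.sInf_nonneg fun _ hx => hx.1

theorem tangentAngle_le (t : ℝ) : tangentAngle μ t ≤ 2 * π :=
  csInf_le (bddBelow_quantile μ _) (two_pi_mem (min_le_right _ _))

/-- Inverse transform sampling: the times in `(0, 1]` with angle at most `a` form the interval `(0,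
F_μ(a)]`. -/
theorem map_tangentAngle : (volume.restrict (Ioc (0 : ℝ) 1)).map (tangentAngle μ) = μ.map rep := by
  have hm : Measurable (tangentAngle μ) := monotone_tangentAngle.measurable
  have : IsFiniteMeasure ((volume.restrict (Ioc (0 : ℝ) 1)).map (tangentAngle μ)) := by
    infer_instance
  refine Measure.ext_of_Iic _ _ fun a => ?_
  rw [Measure.map_apply hm measurableSet_Iic, Measure.restrict_apply (hm measurableSet_Iic)]
  have hF1 : cdf μ a ≤ 1 := measureReal_le_one
  have : tangentAngle μ ⁻¹' Iic a ∩ Ioc 0 1 = Ioc 0 (cdf μ a) := by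
    ext y
    simp only [mem_inter_iff, mem_preimage, mem_Iic, mem_Ioc]
    constructor
    · rintro ⟨h, h0, h1⟩
      rw [tangentAngle, min_eq_left h1, quantile_le_iff h0 h1] at h
      exact ⟨h0, h⟩
    · rintro ⟨h0, h⟩
      have h1 := h.trans hF1
      refine ⟨?_, h0, h1⟩
      rwa [tangentAngle, min_eq_left h1, quantile_le_iff h0 h1]
  rw [this, Real.volume_Ioc, sub_zero, cdf_eq, ProbabilityTheory.ofReal_cdf]

theorem map_coe_tangentAngle :
    (volume.restrict (Ioc (0 : ℝ) 1)).map (fun t => (tangentAngle μ t : Torus)) = μ := by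
  have h : (fun t => (tangentAngle μ t : Torus)) = (fun x : ℝ => (x : Torus)) ∘ tangentAngle μ := rfl
  have hc : Measurable (fun x : ℝ => (x : Torus)) := (AddCircle.continuous_mk' (2 * π)).measurable
  rw [h, ← Measure.map_map hc monotone_tangentAngle.measurable, map_tangentAngle,
    Measure.map_map hc measurable_rep]
  have : (fun x : ℝ => (x : Torus)) ∘ rep = id := funext coe_rep
  rw [this, Measure.map_id]

end Quantile

/-! ### The uniform law: its circle, absorption and centring. -/

section Uniform

instance : IsProbabilityMeasure uniformLaw := inferInstanceAs (IsProbabilityMeasure AddCircle.haarAddCircle)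

theorem cdf_uniformLaw {x : ℝ} (h0 : 0 ≤ x) (h2 : x < 2 * π) : cdf uniformLaw x = x / (2 * π) := by
  have hA : MeasurableSet ((fun y : ℝ => (y : Torus)) '' Icc 0 x) := by
    rw [image_coe_Icc]; exact measurable_rep measurableSet_Iic
  have hv : (volume : Measure Torus) ((fun y : ℝ => (y : Torus)) '' Icc 0 x) = ENNReal.ofReal x := by
    have hc : Measurable (QuotientAddGroup.mk : ℝ → Torus) :=
      (AddCircle.continuous_mk' (2 * π)).measurable
    have hpre := (AddCircle.measurePreserving_mk (2 * π) 0).measure_preimage hA.nullMeasurableSet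
    rw [← hpre]
    change volume.restrict (Ioc 0 (0 + 2 * π)) (QuotientAddGroup.mk ⁻¹' _) = _
    rw [Measure.restrict_apply (hc hA), zero_add]
    refine le_antisymm ?_ ?_
    -- The fundamental domain `(0, 2π]` represents the point `0` by `2π`, hence the extra singleton.
    · have hsub : (QuotientAddGroup.mk ⁻¹' ((fun y : ℝ => (y : Torus)) '' Icc 0 x) ∩ Ioc 0 (2 * π)) ⊆
          Ioc 0 x ∪ {2 * π} := by
        rintro t ⟨ht, ht'⟩
        rcases ht'.2.lt_or_eq with h | h
        · rw [image_coe_Icc] at ht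
          have : rep (t : Torus) ≤ x := ht
          rw [rep_coe ⟨ht'.1.le, h⟩] at this
          exact Or.inl ⟨ht'.1, this⟩
        · exact Or.inr h
      refine (measure_mono hsub).trans ((measure_union_le _ _).trans ?_)
      simp
    · have hsub : Ioc 0 x ⊆ (QuotientAddGroup.mk ⁻¹' ((fun y : ℝ => (y : Torus)) '' Icc 0 x) ∩
          Ioc 0 (2 * π)) := fun t ht => ⟨⟨t, ⟨ht.1.le, ht.2⟩, rfl⟩, ht.1, ht.2.trans h2.le⟩
      refine le_trans ?_ (measure_mono hsub)
      simp
  rw [AddCircle.volume_eq_smul_haarAddCircle, Measure.smul_apply, smul_eq_mul] at hv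
  have := congrArg ENNReal.toReal hv
  rw [ENNReal.toReal_mul, ENNReal.toReal_ofReal Real.two_pi_pos.le, ENNReal.toReal_ofReal h0] at this
  rw [eq_div_iff Real.two_pi_pos.ne', mul_comm]
  exact this

theorem quantile_uniformLaw {t : ℝ} (ht : t ∈ Icc (0 : ℝ) 1) :
    quantile uniformLaw t = 2 * π * t := by
  have hp := Real.two_pi_pos
  have : IsLeast {x : ℝ | 0 ≤ x ∧ t ≤ cdf uniformLaw x} (2 * π * t) := by
    refine ⟨⟨mul_nonneg hp.le ht.1, ?_⟩, fun x hx => ?_⟩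
    · rcases ht.2.lt_or_eq with h | h
      · rw [cdf_uniformLaw (mul_nonneg hp.le ht.1) (by nlinarith), mul_div_cancel_left₀ _ hp.ne']
      · rw [h, mul_one, cdf_two_pi]
    · by_contra hlt
      rw [not_le] at hlt
      have h3 := hx.2
      rw [cdf_uniformLaw hx.1 (by nlinarith [ht.2]), le_div_iff₀ hp] at h3
      linarith
  exact this.csInf_eq

theorem curve_uniformLaw {t : ℝ} (ht : t ∈ Icc (0 : ℝ) 1) :
    curve uniformLaw t = Complex.I / (2 * (π : ℂ)) +
      Complex.exp (2 * π * Complex.I * t) / (2 * π * Complex.I) := by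
  have hπ : (π : ℂ) ≠ 0 := by exact_mod_cast Real.pi_pos.ne'
  have hI := Complex.I_ne_zero
  have h : curve uniformLaw t = ∫ u in (0 : ℝ)..t, Complex.exp (2 * π * Complex.I * u) := by
    refine intervalIntegral.integral_congr fun u hu => ?_
    rw [uIcc_of_le ht.1] at hu
    rw [quantile_uniformLaw ⟨hu.1, hu.2.trans ht.2⟩]
    congr 1
    push_cast
    ring
  rw [h, integral_exp_mul_complex (by simp [hπ]), Complex.ofReal_zero, mul_zero, Complex.exp_zero]
  field_simp
  rw [Complex.I_sq]
  ring

theorem boundaryCurve_uniformLaw : boundaryCurve uniformLaw =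
    Metric.sphere (Complex.I / (2 * (π : ℂ))) (1 / (2 * π)) := by
  have hπ : (π : ℂ) ≠ 0 := by exact_mod_cast Real.pi_pos.ne'
  have hI := Complex.I_ne_zero
  have hn : ‖2 * (π : ℂ) * Complex.I‖ = 2 * π := by
    simp [abs_of_pos Real.pi_pos]
  ext z
  rw [mem_sphere_iff_norm]
  constructor
  · rintro ⟨t, ht, rfl⟩
    have : 2 * (π : ℂ) * Complex.I * t = ((2 * π * t : ℝ) : ℂ) * Complex.I := by push_cast; ring
    rw [curve_uniformLaw ht, add_sub_cancel_left, norm_div, hn, this, Complex.norm_exp_ofReal_mul_I]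
  · intro hz
    set w := (z - Complex.I / (2 * (π : ℂ))) * (2 * π * Complex.I) with hw
    have hw1 : ‖w‖ = 1 := by
      rw [hw, norm_mul, hz, hn, one_div_mul_cancel Real.two_pi_pos.ne']
    have hz' : z = Complex.I / (2 * (π : ℂ)) + w / (2 * π * Complex.I) := by
      rw [hw, mul_div_cancel_right₀ _ (by simp [hπ])]; ring
    have harg : Complex.exp (w.arg * Complex.I) = w := by
      have := Complex.norm_mul_exp_arg_mul_I w
      rwa [hw1, Complex.ofReal_one, one_mul] at this
    have hp := Real.two_pi_pos
    -- The argument lies in `(-π, π]`, so negative values need one more turn to give a time in `[0,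
    -- 1]`.
    rcases le_or_gt 0 w.arg with h | h
    · have ht : w.arg / (2 * π) ∈ Icc (0 : ℝ) 1 :=
        ⟨by positivity, (div_le_one hp).2 (by linarith [Complex.arg_le_pi w, Real.pi_pos])⟩
      refine ⟨_, ht, ?_⟩
      rw [curve_uniformLaw ht, hz', ← harg]
      congr 3
      rw [harg]
      push_cast
      field_simp
    · have ht : w.arg / (2 * π) + 1 ∈ Icc (0 : ℝ) 1 := by
        constructor
        · rw [← neg_le_iff_add_nonneg, le_div_iff₀ hp]
          linarith [Complex.neg_pi_lt_arg w, Real.pi_pos]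
        · have := div_neg_of_neg_of_pos h hp
          linarith
      refine ⟨_, ht, ?_⟩
      rw [curve_uniformLaw ht, hz']
      congr 2
      have : 2 * (π : ℂ) * Complex.I * ((w.arg / (2 * π) + 1 : ℝ) : ℂ) =
          w.arg * Complex.I + 2 * π * Complex.I := by
        push_cast
        field_simp
      rw [this, Complex.exp_periodic, harg]

theorem convexSet_uniformLaw : convexSet uniformLaw =
    Metric.closedBall (Complex.I / (2 * (π : ℂ))) (1 / (2 * π)) := by
  rw [convexSet, boundaryCurve_uniformLaw, convexHull_sphere_eq_closedBall _ (by positivity)]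

/-- Translation invariance makes the inner integral of `f (x + y)` independent of `x`. -/
theorem conv_uniformLaw (ν : Measure Torus) [IsProbabilityMeasure ν] :
    Measure.conv ν uniformLaw = uniformLaw := by
  have : uniformLaw.IsAddLeftInvariant := inferInstanceAs (AddCircle.haarAddCircle.IsAddLeftInvariant)
  refine Measure.ext_of_lintegral _ fun f hf => ?_
  rw [Measure.lintegral_conv hf]
  simp_rw [lintegral_add_left_eq_self]
  simp

theorem uniformLaw_conv (ν : Measure Torus) [IsProbabilityMeasure ν] :
    Measure.conv uniformLaw ν = uniformLaw := by
  rw [Measure.conv_comm, conv_uniformLaw]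

theorem uniformLaw_mem : uniformLaw ∈ centredLaws := by
  have : uniformLaw.IsAddLeftInvariant := inferInstanceAs (AddCircle.haarAddCircle.IsAddLeftInvariant)
  -- Translation by `π` preserves the law and changes the sign of `expI`.
  refine ⟨inferInstance, integral_eq_zero_of_add_left_eq_neg (g := ((π : ℝ) : Torus)) fun x => ?_⟩
  rw [expI, AddCircle.toCircle_add, Circle.coe_mul, ← expI, ← expI, expI_coe, mul_comm Complex.I,
    Complex.exp_pi_mul_I, neg_one_mul]

end Uniform

/-! ### Area as a Fourier series, and its behaviour under convolution. -/

section Area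

theorem expI_eq_fourier (θ : Torus) : expI θ = fourier 1 θ := by
  rw [expI, fourier_one]

theorem measurable_expI : Measurable expI := by
  have : expI = fun θ => fourier 1 θ := funext expI_eq_fourier
  rw [this]
  exact (map_continuous (fourier 1)).measurable

variable {μ ν : Measure Torus}

theorem arc_tangentAngle (μ : Measure Torus) {t : ℝ} (ht : t ∈ Icc (0 : ℝ) 1) :
    arc (tangentAngle μ) t = curve μ t := by
  refine intervalIntegral.integral_congr fun u hu => ?_
  rw [uIcc_of_le ht.1] at hu
  simp only [tangentAngle, min_eq_left (hu.2.trans ht.2)]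

/-- Transporting the centring integral to the unit interval gives exactly the end point of the
curve. -/
theorem arc_tangentAngle_one [IsProbabilityMeasure μ] (h : ∫ θ, expI θ ∂μ = 0) :
    arc (tangentAngle μ) 1 = 0 := by
  have hm : Measurable fun t => (tangentAngle μ t : Torus) :=
    (AddCircle.continuous_mk' (2 * π)).measurable.comp monotone_tangentAngle.measurable
  rw [← map_coe_tangentAngle (μ := μ), integral_map hm.aemeasurable
    measurable_expI.aestronglyMeasurable] at h
  rw [arc, intervalIntegral.integral_of_le zero_le_one, ← h]
  simp_rw [expI_coe]

theorem integral_kernel [IsProbabilityMeasure μ] (h : ∫ θ, expI θ ∂μ = 0) :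
    ∫ z, kernel (z.1 - z.2) ∂μ.prod μ = ((4 * ∫ t in (0 : ℝ)..1,
      (arc (tangentAngle μ) t).re * Real.sin (tangentAngle μ t) : ℝ) : ℂ) := by
  have hΘ := monotone_tangentAngle (μ := μ)
  have hΘm := hΘ.measurable
  have h1 := arc_tangentAngle_one h
  have h0 := tangentAngle_nonneg μ
  have h2 := tangentAngle_le (μ := μ)
  have hm : Measurable fun t => (tangentAngle μ t : Torus) :=
    (AddCircle.continuous_mk' (2 * π)).measurable.comp monotone_tangentAngle.measurable
  have hmap : μ.prod μ = (unitLaw.prod unitLaw).map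
      (Prod.map (fun t => (tangentAngle μ t : Torus)) fun t => (tangentAngle μ t : Torus)) := by
    rw [← Measure.map_prod_map _ _ hm hm, map_coe_tangentAngle]
  rw [hmap, integral_map (hm.prodMap hm).aemeasurable
    (Continuous.aestronglyMeasurable (by fun_prop)), ← integral_sin_abs hΘ h1]
  have hd : ∀ z : ℝ × ℝ, |tangentAngle μ z.1 - tangentAngle μ z.2| ≤ 2 * π := fun z =>
    abs_sub_le_iff.2 ⟨by linarith [h0 z.2, h2 z.1], by linarith [h0 z.1, h2 z.2]⟩
  simp only [Prod.map_fst, Prod.map_snd, ← AddCircle.coe_sub]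
  simp_rw [fun z : ℝ × ℝ => kernel_coe (hd z)]
  rw [integral_complex_ofReal, integral_sub, integral_div, integral_sub_mul_sin_sub hΘ h0 h2 h1, zero_div,
    sub_zero]
  · exact integrable_of_bounded 1 (Measurable.aestronglyMeasurable (by fun_prop))
      fun z => Real.abs_sin_le_one _
  · refine Integrable.div_const (integrable_of_bounded (2 * π)
      (Measurable.aestronglyMeasurable (by fun_prop)) fun z => ?_) _
    rw [norm_mul]
    calc _ ≤ 2 * π * 1 := mul_le_mul (hd z) (Real.abs_sin_le_one _) (abs_nonneg _)
          Real.two_pi_pos.le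
      _ = 2 * π := mul_one _

/-- The area in terms of the Fourier coefficients of the law of the tangent angle. -/
theorem exists_area_eq (h : μ ∈ centredLaws) : ∃ a : ℝ, area μ = ENNReal.ofReal a ∧
    HasSum (fun n : ℤ => (fourierCoeff kernel n).re * ‖∫ x, fourier n x ∂μ‖ ^ 2) (4 * a) := by
  have := h.1
  refine ⟨∫ t in (0 : ℝ)..1, (arc (tangentAngle μ) t).re * Real.sin (tangentAngle μ t), ?_, ?_⟩
  rotate_left
  · have hs := hasSum_kernel_energy μ
    rw [integral_kernel h.2] at hs
    have hr := Complex.hasSum_re hs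
    simpa only [Complex.re_mul_ofReal, Complex.ofReal_re] using hr
  · rw [area, convexSet, boundaryCurve, ← volume_convexHull_arc monotone_tangentAngle
      (tangentAngle_nonneg μ) tangentAngle_le (arc_tangentAngle_one h.2)]
    congr 2
    exact image_congr fun t ht => (arc_tangentAngle μ ht).symm

theorem integral_fourier_conv [IsProbabilityMeasure μ] [IsProbabilityMeasure ν] (n : ℤ) :
    ∫ x, fourier n x ∂(Measure.conv μ ν) = (∫ x, fourier n x ∂μ) * ∫ x, fourier n x ∂ν := by
  rw [Measure.conv, integral_map (by fun_prop) (Continuous.aestronglyMeasurable (by fun_prop)),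
    ← integral_prod_mul (fun x => (fourier n x : ℂ)) (fun x => (fourier n x : ℂ))]
  refine integral_congr_ae (Filter.Eventually.of_forall fun z => ?_)
  simp only [fourier_apply, smul_add, AddCircle.toCircle_add, Circle.coe_mul]

theorem conv_mem_centredLaws (hμ : μ ∈ centredLaws) (hν : ν ∈ centredLaws) :
    Measure.conv μ ν ∈ centredLaws := by
  have := hμ.1
  have := hν.1
  refine ⟨inferInstance, ?_⟩
  have h := hμ.2
  simp_rw [expI_eq_fourier] at h ⊢
  rw [integral_fourier_conv, h, zero_mul]

theorem norm_integral_fourier_le_one [IsProbabilityMeasure ν] (n : ℤ) :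
    ‖∫ x, fourier n x ∂ν‖ ≤ 1 := by
  have := norm_integral_le_of_norm_le_const (μ := ν) (f := fun x => (fourier n x : ℂ)) (C := 1)
    (Filter.Eventually.of_forall fun x => by rw [fourier_apply, Circle.norm_coe])
  simpa using this

theorem fourierCoeff_kernel_re_nonpos {n : ℤ} (h0 : n ≠ 0) (h1 : n ≠ 1) (h2 : n ≠ -1) :
    (fourierCoeff kernel n).re ≤ 0 := by
  rw [fourierCoeff_kernel h1 h2, Complex.ofReal_re]
  have : (1 : ℤ) ≤ n ^ 2 := by
    have := sq_pos_of_ne_zero h0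
    omega
  have h : (1 : ℝ) ≤ (n : ℝ) ^ 2 := by exact_mod_cast this
  exact div_nonpos_of_nonpos_of_nonneg (by norm_num)
    (mul_nonneg Real.pi_pos.le (sub_nonneg.2 h))

theorem area_le_area_conv (hμ : μ ∈ centredLaws) (hν : ν ∈ centredLaws) :
    area μ ≤ area (Measure.conv μ ν) := by
  have := hμ.1
  have := hν.1
  obtain ⟨a, ha, hsa⟩ := exists_area_eq hμ
  obtain ⟨b, hb, hsb⟩ := exists_area_eq (conv_mem_centredLaws hμ hν)
  rw [ha, hb]
  refine ENNReal.ofReal_le_ofReal ?_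
  suffices 4 * a ≤ 4 * b by linarith
  refine hasSum_le (fun n => ?_) hsa hsb
  rw [integral_fourier_conv, norm_mul, mul_pow]
  have hzero : ∫ x, fourier 1 x ∂μ = 0 := by simpa only [expI_eq_fourier] using hμ.2
  -- The coefficient `c_0` is positive, so equality is needed here: both laws have total mass `1`.
  by_cases h0 : n = 0
  · subst h0; simp
  -- For `n = ±1` centring kills both sides, whatever the kernel coefficient.
  by_cases h1 : n = 1
  · subst h1; rw [hzero]; simp
  by_cases h2 : n = -1
  · subst h2
    have : ∫ x : Torus, fourier (-1) x ∂μ = 0 := by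
      simp_rw [fourier_neg]
      rw [integral_conj, hzero, map_zero]
    rw [this]; simp
  · refine mul_le_mul_of_nonpos_left ?_ (fourierCoeff_kernel_re_nonpos h0 h1 h2)
    exact mul_le_of_le_one_right (sq_nonneg _)
      (pow_le_one₀ (norm_nonneg _) (norm_integral_fourier_le_one n))

end Area

end CCS

theorem mainTheorem5 :
    (∀ μ ∈ CCS.centredLaws, ∀ ν ∈ CCS.centredLaws,
      Measure.conv μ ν ∈ CCS.centredLaws ∧
        max (CCS.area μ) (CCS.area ν) ≤ CCS.area (Measure.conv μ ν)) ∧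
    CCS.uniformLaw ∈ CCS.centredLaws ∧
    (∀ ν : Measure CCS.Torus, IsProbabilityMeasure ν →
      Measure.conv CCS.uniformLaw ν = CCS.uniformLaw ∧
        Measure.conv ν CCS.uniformLaw = CCS.uniformLaw) ∧
    CCS.boundaryCurve CCS.uniformLaw =
      Metric.sphere (Complex.I / (2 * (π : ℂ))) (1 / (2 * π)) ∧
    CCS.convexSet CCS.uniformLaw =
      Metric.closedBall (Complex.I / (2 * (π : ℂ))) (1 / (2 * π)) ∧
    (∀ ν ∈ CCS.centredLaws, CCS.area ν ≤ CCS.area CCS.uniformLaw) := by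
  refine ⟨fun μ hμ ν hν => ⟨CCS.conv_mem_centredLaws hμ hν,
    max_le (CCS.area_le_area_conv hμ hν) ?_⟩, CCS.uniformLaw_mem, fun ν _ =>
    ⟨CCS.uniformLaw_conv ν, CCS.conv_uniformLaw ν⟩, CCS.boundaryCurve_uniformLaw,
    CCS.convexSet_uniformLaw, fun ν hν => ?_⟩
  · have := hμ.1
    have := hν.1
    rw [Measure.conv_comm]
    exact CCS.area_le_area_conv hν hμ
  · have := hν.1
    -- Convolving with the uniform law gives the uniform law, so monotonicity of the area is the
    -- isoperimetric inequality.
    have h := CCS.area_le_area_conv hν CCS.uniformLaw_mem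
    rwa [CCS.conv_uniformLaw] at h
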